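/- Let $k\ge 3$ be an integer. For a Dirichlet character $\chi$ mod $k$, call $\chi$ odd if $\chi(-1)=-1$, and let $L(3,\chi)=\sum_{n=1}^{\infty}\chi(n)n^{-3}$. Let $\phi$ be Euler's totient function and, for a positive integer $s$, let $J_s(k)=k^s\prod_{p\mid k,\ p\text{ prime}}\left(1-\frac{1}{p^s}\right)$ be Jordan's totient function. Then $$\sum_{\substack{\chi \bmod k\\ \chi\text{ odd}}}|L(3,\chi)|^2=\frac{\pi^6}{90k^6}\,\phi(k)\left(\frac{J_6(k)}{21}-J_2(k)\right),$$ and consequently the average of $|L(3,\chi)|^2$ over the odd Dirichlet characters mod $k$ (the sum above divided by the number of odd characters mod $k$) equals $$\frac{2\pi^6}{90k^6}\left(\frac{J_6(k)}{21}-J_2(k)\right).$$ -/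

import Mathlib

/-- Jordan's totient function `J_s(n) = n ^ s * ∏_{p ∣ n, p prime} (1 - 1 / p ^ s)`,
as a real number. -/
noncomputable def jordanTotient (s n : ℕ) : ℝ :=
  (n : ℝ) ^ s * ∏ p ∈ n.primeFactors, (1 - 1 / (p : ℝ) ^ s)

open Classical in
/-- The finite set of the odd Dirichlet characters mod `k`, those with `χ (-1) = -1`. -/
noncomputable def oddCharacters (k : ℕ) : Finset (DirichletCharacter ℂ k) :=
  Finset.univ.filter fun χ => χ.Odd

open Finset

/-! For odd `χ`, `L(3,χ)` is `k⁻³` times the pairing of `χ` with the odd function `j ↦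
hurwitzZetaOdd (j/k) 3`. Even characters pair to zero with it, so orthogonality over all characters
leaves `φ(k) k⁻⁶` times the sum of its squared values over the units mod `k`. The same sum over all
of `ZMod N` follows from Parseval: the Fourier transform is a sine zeta value, hence the cubic
Bernoulli polynomial at `a/N`, and power sums give a multiple of `N⁶ - 21N² + 20`. Grouping
fractions by reduced denominator and applying Möbius inversion turns `N^s` into `J_s` and isolates
the units. -/

lemma jordanTotient_mul_of_coprime (s : ℕ) {m n : ℕ} (h : m.Coprime n) :
    jordanTotient s (m * n) = jordanTotient s m * jordanTotient s n := by
  simp only [jordanTotient]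
  rw [h.primeFactors_mul, prod_union h.disjoint_primeFactors]
  push_cast
  ring

lemma jordanTotient_one (s : ℕ) : jordanTotient s 1 = 1 := by
  simp [jordanTotient]

lemma jordanTotient_prime_pow_succ (s : ℕ) {p : ℕ} (hp : p.Prime) (e : ℕ) :
    jordanTotient s (p ^ (e + 1)) = ((p ^ (e + 1) : ℕ) : ℝ) ^ s - ((p ^ e : ℕ) : ℝ) ^ s := by
  have hp0 : (p : ℝ) ≠ 0 := by exact_mod_cast hp.ne_zero
  rw [jordanTotient, Nat.primeFactors_prime_pow e.succ_ne_zero hp, prod_singleton]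
  push_cast
  rw [pow_succ (p : ℝ) e, mul_pow]
  field_simp

/-- The divisor sums of Jordan's totient function are the powers. -/
lemma sum_divisors_jordanTotient {s : ℕ} (hs : s ≠ 0) (n : ℕ) :
    ∑ d ∈ n.divisors, jordanTotient s d = (n : ℝ) ^ s := by
  let J : ArithmeticFunction ℝ := ⟨jordanTotient s, by simp [jordanTotient, hs]⟩
  let P : ArithmeticFunction ℝ := ⟨fun n => (n : ℝ) ^ s, by simp [hs]⟩
  have hJ : J.IsMultiplicative :=
    ⟨jordanTotient_one s, fun h => jordanTotient_mul_of_coprime s h⟩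
  have hP : P.IsMultiplicative :=
    ⟨by simp [P], fun {m n} _ => by simp [P, mul_pow]⟩
  have hJζ : (J * (ArithmeticFunction.zeta : ArithmeticFunction ℝ)).IsMultiplicative :=
    hJ.mul ArithmeticFunction.isMultiplicative_zeta.natCast
  have key : J * (ArithmeticFunction.zeta : ArithmeticFunction ℝ) = P := by
    refine (hJζ.eq_iff_eq_on_prime_powers _ _ hP).2 fun p i hp => ?_
    rw [ArithmeticFunction.coe_mul_zeta_apply, Nat.sum_divisors_prime_pow hp]
    change ∑ x ∈ range (i + 1), jordanTotient s (p ^ x) = ((p ^ i : ℕ) : ℝ) ^ s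
    induction i with
    | zero => simp [jordanTotient_one]
    | succ i ih => rw [sum_range_succ, ih, jordanTotient_prime_pow_succ s hp]; ring
  have := congrArg (fun f => f n) key
  simp only [ArithmeticFunction.coe_mul_zeta_apply] at this
  exact this

/-- A function on the positive integers is determined by its divisor sums. -/
lemma eq_of_sum_divisors_eq {R : Type*} [CommRing R] {f g : ℕ → R}
    (h : ∀ n > 0, ∑ d ∈ n.divisors, f d = ∑ d ∈ n.divisors, g d) {n : ℕ} (hn : 0 < n) :
    f n = g n := by
  have hf := (ArithmeticFunction.sum_eq_iff_sum_mul_moebius_eq (f := f)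
    (g := fun n => ∑ d ∈ n.divisors, g d)).1 h n hn
  have hg := (ArithmeticFunction.sum_eq_iff_sum_mul_moebius_eq (f := g)
    (g := fun n => ∑ d ∈ n.divisors, g d)).1 (fun _ _ => rfl) n hn
  rw [← hf, ← hg]

/-- Summing over the fractions `a / n` by their reduced denominators. -/
lemma sum_range_div_eq_sum_divisors {M : Type*} [AddCommMonoid M] (F : ℝ → M) {n : ℕ}
    (hn : 0 < n) :
    ∑ a ∈ range n, F (a / n) =
      ∑ d ∈ n.divisors, ∑ b ∈ range d with d.Coprime b, F (b / d) := by
  have hmaps : ∀ a ∈ range n, n.gcd a ∈ n.divisors := fun a _ =>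
    Nat.mem_divisors.2 ⟨Nat.gcd_dvd_left n a, hn.ne'⟩
  rw [← sum_fiberwise_of_maps_to hmaps,
    ← Nat.sum_div_divisors n fun d => ∑ b ∈ range d with d.Coprime b, F (b / d)]
  refine sum_congr rfl fun d hd => ?_
  obtain ⟨x, rfl⟩ := Nat.dvd_of_mem_divisors hd
  have hd0 : 0 < d := Nat.pos_of_mul_pos_right hn
  rw [Nat.mul_div_cancel_left x hd0]
  symm
  refine sum_bij (fun b _ => d * b) ?_ ?_ ?_ ?_
  · simp only [mem_filter, mem_range, and_imp]
    intro b hb1 hb2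
    refine ⟨by gcongr, ?_⟩
    rw [Nat.gcd_mul_left, hb2, mul_one]
  · intro b _ c _ h
    exact Nat.eq_of_mul_eq_mul_left hd0 h
  · simp only [mem_filter, mem_range, exists_prop, and_imp]
    intro b hb1 hb2
    obtain ⟨q, rfl⟩ : d ∣ b := hb2 ▸ Nat.gcd_dvd_right _ b
    refine ⟨q, ⟨(mul_lt_mul_iff_right₀ hd0).1 hb1, ?_⟩, rfl⟩
    rwa [Nat.gcd_mul_left, Nat.mul_eq_left hd0.ne'] at hb2
  · intro b _
    have : (d : ℝ) ≠ 0 := by exact_mod_cast hd0.ne'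
    push_cast
    rw [mul_div_mul_left _ _ this]

lemma sum_zmod_val_eq_sum_range {M : Type*} [AddCommMonoid M] (n : ℕ) [NeZero n]
    (F : ℕ → M) : ∑ j : ZMod n, F j.val = ∑ a ∈ range n, F a := by
  refine sum_bij (fun j _ => j.val) (fun j _ => mem_range.2 j.val_lt)
    (fun i _ j _ h => ZMod.val_injective n h) (fun a ha => ?_) (fun _ _ => rfl)
  exact ⟨(a : ZMod n), mem_univ _, ZMod.val_cast_of_lt (mem_range.1 ha)⟩

lemma sum_units_val_eq_sum_coprime {M : Type*} [AddCommMonoid M] (n : ℕ) [NeZero n]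
    (F : ℕ → M) :
    ∑ u : (ZMod n)ˣ, F (u : ZMod n).val = ∑ a ∈ range n with n.Coprime a, F a := by
  refine sum_bij (fun u _ => (u : ZMod n).val) (fun u _ => ?_)
    (fun i _ j _ h => Units.ext (ZMod.val_injective n h)) (fun a ha => ?_) (fun _ _ => rfl)
  · exact mem_filter.2 ⟨mem_range.2 (ZMod.val_lt _), (ZMod.val_coe_unit_coprime u).symm⟩
  · obtain ⟨h1, h2⟩ := mem_filter.1 ha
    refine ⟨ZMod.unitOfCoprime a h2.symm, mem_univ _, ?_⟩
    rw [ZMod.coe_unitOfCoprime, ZMod.val_cast_of_lt (mem_range.1 h1)]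

open HurwitzZeta in
/-- The odd Hurwitz zeta value `hurwitzZetaOdd x 3` appears in the value at `3` of the L-series of
an odd periodic function. -/
lemma LSeries_three_of_odd {k : ℕ} [NeZero k] {χ : DirichletCharacter ℂ k} (hχ : χ.Odd) :
    LSeries (fun n : ℕ => χ (n : ZMod k)) 3 =
      (k : ℂ) ^ (-3 : ℂ) * ∑ j : ZMod k, χ j * hurwitzZetaOdd (ZMod.toAddCircle j) 3 := by
  rw [← ZMod.LFunction_def_odd hχ.to_fun 3]
  exact (ZMod.LFunction_eq_LSeries (fun j => χ j) (by norm_num)).symm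

-- Characters vanish off the units; after expanding the square, orthogonality kills every term with
-- `u ≠ v`.
open ComplexConjugate in
lemma sum_norm_sq_sum_dirichletCharacter_mul {k : ℕ} [NeZero k] (f : ZMod k → ℂ) :
    ∑ χ : DirichletCharacter ℂ k, ‖∑ j, χ j * f j‖ ^ 2 =
      (k.totient : ℝ) * ∑ u : (ZMod k)ˣ, ‖f u‖ ^ 2 := by
  have hunits (χ : DirichletCharacter ℂ k) :
      ∑ j, χ j * f j = ∑ u : (ZMod k)ˣ, χ u * f u := by
    symm
    refine sum_of_injOn (fun u : (ZMod k)ˣ => (u : ZMod k)) (fun _ _ _ _ h => Units.ext h)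
      (fun _ _ => mem_coe.2 (mem_univ _)) (fun j _ hj => ?_) (fun _ _ => rfl)
    rw [MulChar.map_nonunit χ, zero_mul]
    rintro ⟨u, rfl⟩
    exact hj ⟨u, mem_coe.2 (mem_univ _), rfl⟩
  have hconj (χ : DirichletCharacter ℂ k) (u : (ZMod k)ˣ) :
      conj (χ u) = χ (u : ZMod k)⁻¹ := by
    have := MulChar.star_apply' χ (u : ZMod k)
    rw [MulChar.inv_apply, Ring.inverse_unit] at this
    rwa [ZMod.inv_coe_unit]
  apply Complex.ofReal_injective
  push_cast
  simp_rw [hunits, ← Complex.conj_mul', map_sum, map_mul, hconj, sum_mul_sum]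
  rw [sum_comm]
  simp_rw [sum_comm (γ := DirichletCharacter ℂ k), mul_sum]
  refine sum_congr rfl fun u _ => ?_
  have (v : (ZMod k)ˣ) : ∑ χ : DirichletCharacter ℂ k,
      χ (u : ZMod k)⁻¹ * conj (f u) * (χ v * f v) =
      if u = v then (k.totient : ℂ) * (conj (f u) * f u) else 0 := by
    have h := DirichletCharacter.sum_char_inv_mul_char_eq ℂ u.isUnit (v : ZMod k)
    calc _ = (∑ χ : DirichletCharacter ℂ k, χ (u : ZMod k)⁻¹ * χ v) * (conj (f u) * f v) := by
          rw [sum_mul]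
          exact sum_congr rfl fun _ _ => by ring
      _ = _ := by
          rw [h]
          by_cases huv : u = v
          · simp [huv]
          · simp [huv, Units.ext_iff.not.1 huv]
  simp only [this, sum_ite_eq, mem_univ, if_true]

lemma sum_dirichletCharacter_mul_eq_zero {k : ℕ} [NeZero k] {χ : DirichletCharacter ℂ k}
    (hχ : χ.Even) {f : ZMod k → ℂ} (hf : f.Odd) : ∑ j, χ j * f j = 0 :=
  (hχ.to_fun.mul_odd hf).sum_eq_zero

lemma mem_oddCharacters {k : ℕ} {χ : DirichletCharacter ℂ k} : χ ∈ oddCharacters k ↔ χ.Odd := by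
  classical simp [oddCharacters]

lemma sum_oddCharacters_norm_sq {k : ℕ} [NeZero k] {f : ZMod k → ℂ} (hf : f.Odd) :
    ∑ χ ∈ oddCharacters k, ‖∑ j, χ j * f j‖ ^ 2 =
      (k.totient : ℝ) * ∑ u : (ZMod k)ˣ, ‖f u‖ ^ 2 := by
  rw [← sum_norm_sq_sum_dirichletCharacter_mul]
  refine sum_subset (subset_univ _) fun χ _ hχ => ?_
  have : ¬ χ.Odd := fun h => hχ (mem_oddCharacters.2 h)
  rw [sum_dirichletCharacter_mul_eq_zero (χ.even_or_odd.resolve_right this) hf]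
  simp

/-- In `∑ (1 - χ (-1))` odd characters count 2 and even ones 0, while `∑ χ (-1) = 0` because `-1 ≠
1` when `k ≥ 3`. -/
lemma two_mul_card_oddCharacters {k : ℕ} (hk : 3 ≤ k) :
    2 * ((oddCharacters k).card : ℝ) = k.totient := by
  have : NeZero k := ⟨by omega⟩
  have : Fact (2 < k) := ⟨hk⟩
  have h0 : ∑ χ : DirichletCharacter ℂ k, χ (-1) = 0 :=
    DirichletCharacter.sum_characters_eq_zero ℂ (ZMod.neg_one_ne_one)
  have h1 : ∑ χ : DirichletCharacter ℂ k, (1 : ℂ) = k.totient := by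
    simpa using DirichletCharacter.sum_characters_eq ℂ (1 : ZMod k)
  have h2 : ∑ χ : DirichletCharacter ℂ k, (1 - χ (-1)) = ∑ χ ∈ oddCharacters k, (2 : ℂ) := by
    rw [oddCharacters, sum_filter]
    refine sum_congr rfl fun χ _ => ?_
    split_ifs with h
    · rw [show χ (-1) = -1 from h]; norm_num
    · rw [show χ (-1) = 1 from χ.even_or_odd.resolve_right h, sub_self]
  rw [sum_sub_distrib, h0, h1, sum_const, nsmul_eq_mul, sub_zero] at h2
  have : (k.totient : ℝ) = (oddCharacters k).card * 2 := by exact_mod_cast h2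
  rw [this, mul_comm]

open ComplexConjugate ZMod in
/-- Parseval's identity for the discrete Fourier transform. -/
lemma sum_norm_sq_dft {N : ℕ} [NeZero N] (Φ : ZMod N → ℂ) :
    ∑ a, ‖dft Φ a‖ ^ 2 = (N : ℝ) * ∑ j, ‖Φ j‖ ^ 2 := by
  apply Complex.ofReal_injective
  push_cast
  simp_rw [← Complex.conj_mul']
  have hconj (a : ZMod N) : conj (dft Φ a) = ∑ j, stdAddChar (j * a) * conj (Φ j) := by
    rw [dft_apply, map_sum]
    refine sum_congr rfl fun j _ => ?_
    rw [smul_eq_mul, map_mul, ← AddChar.map_neg_eq_conj, neg_neg]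
  simp_rw [hconj, sum_mul]
  rw [sum_comm, mul_sum]
  refine sum_congr rfl fun j _ => ?_
  -- Fourier inversion: the double transform at `-j` is `N * Φ j`.
  have h := congrFun (dft_dft Φ) (-j)
  rw [dft_apply, neg_neg, smul_eq_mul] at h
  rw [mul_left_comm, ← h, mul_sum]
  refine sum_congr rfl fun a _ => ?_
  rw [mul_neg, neg_neg, smul_eq_mul, mul_comm a j]
  ring

-- The L-function of the odd function `Ψ` is computed twice: from exponential zeta functions, whose
-- cosine parts cancel, and from its expansion in odd Hurwitz zeta values.
open ZMod HurwitzZeta in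
lemma dft_hurwitzZetaOdd {N : ℕ} [NeZero N] {s : ℂ} (hs : s ≠ 1) (a : ZMod N) :
    dft (fun j : ZMod N => hurwitzZetaOdd (toAddCircle j) s) a =
      -Complex.I * (N : ℂ) ^ s * sinZeta (toAddCircle a) s := by
  have hN : (N : ℂ) ≠ 0 := by exact_mod_cast NeZero.ne N
  let Ψ : ZMod N → ℂ := fun j => stdAddChar (-a * j) - stdAddChar (a * j)
  have hodd : Ψ.Odd := fun j => by simp [Ψ]
  have h1 : LFunction Ψ s = -2 * Complex.I * sinZeta (toAddCircle a) s := by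
    have : LFunction Ψ s = LFunction (fun j => stdAddChar (-a * j)) s -
        LFunction (fun j => stdAddChar (a * j)) s := by
      simp only [LFunction, Ψ, sub_mul, sum_sub_distrib, mul_sub]
    rw [this, LFunction_stdAddChar_eq_expZeta _ _ (Or.inr hs),
      LFunction_stdAddChar_eq_expZeta _ _ (Or.inr hs), map_neg]
    simp only [expZeta, cosZeta_neg, sinZeta_neg]
    ring
  have h2 : ∑ j, Ψ j * hurwitzZetaOdd (toAddCircle j) s =
      2 * dft (fun j : ZMod N => hurwitzZetaOdd (toAddCircle j) s) a := by
    simp only [Ψ, sub_mul, sum_sub_distrib]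
    have h3 : ∑ j, stdAddChar (a * j) * hurwitzZetaOdd (toAddCircle j) s =
        - ∑ j, stdAddChar (-a * j) * hurwitzZetaOdd (toAddCircle j) s := by
      rw [← sum_neg_distrib]
      refine Fintype.sum_equiv (.neg _) _ _ fun j => ?_
      simp [hurwitzZetaOdd_neg]
    rw [h3, dft_apply]
    simp only [neg_mul, smul_eq_mul, mul_comm _ a]
    ring
  rw [LFunction_def_odd hodd, h2, Complex.cpow_neg] at h1
  have hNs : (N : ℂ) ^ s ≠ 0 := by simp [Complex.cpow_eq_zero_iff, hN]
  field_simp at h1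
  linear_combination h1

open HurwitzZeta in
lemma sinZeta_three {x : ℝ} (hx : x ∈ Set.Icc (0 : ℝ) 1) :
    sinZeta x 3 = ((2 * Real.pi ^ 3 / 3 * (x ^ 3 - 3 / 2 * x ^ 2 + x / 2) : ℝ) : ℂ) := by
  have h := sinZeta_two_mul_nat_add_one one_ne_zero hx
  norm_num at h
  rw [h]
  simp [Polynomial.bernoulli, sum_range_succ, bernoulli, Nat.choose]
  ring

/-- The square is expanded in powers of `a`, and Faulhaber's formulas are used for exponents 6 down
to 2. Keeping `x` separate from `n` lets the induction go through; later both equal `N`. -/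
lemma sum_range_bernoulli_three_sq (n : ℕ) (x : ℝ) :
    ∑ a ∈ range n, ((a : ℝ) ^ 3 - 3 / 2 * a ^ 2 * x + a * x ^ 2 / 2) ^ 2 =
      ((n : ℝ) - 1) * n * (2 * n - 1) * (3 * n ^ 4 - 6 * n ^ 3 + 3 * n + 1) / 42
      - 3 * x * (((n : ℝ) - 1) ^ 2 * n ^ 2 * (2 * n ^ 2 - 2 * n - 1) / 12)
      + 13 / 4 * x ^ 2 * (((n : ℝ) - 1) * n * (2 * n - 1) * (3 * n ^ 2 - 3 * n - 1) / 30)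
      - 3 / 2 * x ^ 3 * (((n : ℝ) - 1) ^ 2 * n ^ 2 / 4)
      + x ^ 4 / 4 * (((n : ℝ) - 1) * n * (2 * n - 1) / 6) := by
  induction n with
  | zero => simp
  | succ n ih => rw [sum_range_succ, ih]; push_cast; ring

open HurwitzZeta in
lemma sum_norm_sq_hurwitzZetaOdd_three (N : ℕ) [NeZero N] :
    ∑ j : ZMod N, ‖hurwitzZetaOdd (ZMod.toAddCircle j) 3‖ ^ 2 =
      Real.pi ^ 6 / 1890 * ((N : ℝ) ^ 6 - 21 * N ^ 2 + 20) := by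
  have hN : (N : ℝ) ≠ 0 := by exact_mod_cast NeZero.ne N
  have hpos : (0 : ℝ) < N := by exact_mod_cast NeZero.pos N
  have h := sum_norm_sq_dft fun j : ZMod N => hurwitzZetaOdd (ZMod.toAddCircle j) 3
  have hterm (a : ZMod N) :
      ‖ZMod.dft (fun j : ZMod N => hurwitzZetaOdd (ZMod.toAddCircle j) 3) a‖ ^ 2 =
      4 * Real.pi ^ 6 / 9 *
        (((a.val : ℝ) ^ 3 - 3 / 2 * a.val ^ 2 * N + a.val * N ^ 2 / 2) ^ 2) := by
    have hmem : (a.val / N : ℝ) ∈ Set.Icc (0 : ℝ) 1 :=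
      ⟨by positivity, (div_le_one hpos).2 (Nat.cast_le.2 a.val_lt.le)⟩
    rw [dft_hurwitzZetaOdd (by norm_num), ZMod.toAddCircle_apply, sinZeta_three hmem]
    have h3 : ((N : ℂ) ^ (3 : ℂ)) = (N : ℂ) ^ 3 := by
      exact_mod_cast Complex.cpow_natCast (N : ℂ) 3
    rw [h3, norm_mul, norm_mul, norm_neg, Complex.norm_I, one_mul, norm_pow, Complex.norm_natCast,
      Complex.norm_real, Real.norm_eq_abs, mul_pow, sq_abs]
    field_simp
    ring
  simp_rw [hterm] at h
  rw [← mul_sum] at h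
  rw [sum_zmod_val_eq_sum_range N fun a : ℕ =>
    ((a : ℝ) ^ 3 - 3 / 2 * a ^ 2 * N + a * N ^ 2 / 2) ^ 2, sum_range_bernoulli_three_sq] at h
  apply mul_left_cancel₀ hN
  rw [← h]
  ring

open HurwitzZeta in
lemma sum_units_norm_sq_hurwitzZetaOdd_three {k : ℕ} [NeZero k] (hk : k ≠ 1) :
    ∑ u : (ZMod k)ˣ, ‖hurwitzZetaOdd (ZMod.toAddCircle (u : ZMod k)) 3‖ ^ 2 =
      Real.pi ^ 6 / 90 * (jordanTotient 6 k / 21 - jordanTotient 2 k) := by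
  let F : ℝ → ℝ := fun x => ‖hurwitzZetaOdd (x : UnitAddCircle) 3‖ ^ 2
  -- The constant 20 is the divisor sum of a term supported at `d = 1`, so it disappears for `k ≠
  -- 1`.
  have hdiv : ∀ n > 0,
      ∑ d ∈ n.divisors, ∑ b ∈ range d with d.Coprime b, F (b / d) =
      ∑ d ∈ n.divisors, Real.pi ^ 6 / 1890 *
        (jordanTotient 6 d - 21 * jordanTotient 2 d + if d = 1 then 20 else 0) := by
    intro n hn
    have : NeZero n := ⟨hn.ne'⟩
    rw [← sum_range_div_eq_sum_divisors F hn, ← sum_zmod_val_eq_sum_range n fun a : ℕ => F (a / n), ← mul_sum,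
      sum_add_distrib, sum_sub_distrib, ← mul_sum, sum_divisors_jordanTotient (by norm_num),
      sum_divisors_jordanTotient (by norm_num), sum_ite_eq', if_pos (by simp [hn.ne']),
      ← sum_norm_sq_hurwitzZetaOdd_three n]
    exact sum_congr rfl fun j _ => by rw [ZMod.toAddCircle_apply]
  have h := eq_of_sum_divisors_eq hdiv (NeZero.pos k)
  rw [if_neg hk, ← sum_units_val_eq_sum_coprime k fun a : ℕ => F (a / k)] at h
  simp_rw [ZMod.toAddCircle_apply]
  rw [show Real.pi ^ 6 / 90 * (jordanTotient 6 k / 21 - jordanTotient 2 k) =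
    Real.pi ^ 6 / 1890 * (jordanTotient 6 k - 21 * jordanTotient 2 k + 0) by ring, ← h]

open HurwitzZeta in
lemma sum_oddCharacters_norm_sq_LSeries_three {k : ℕ} (hk : 3 ≤ k) :
    ∑ χ ∈ oddCharacters k, ‖LSeries (fun n : ℕ => χ (n : ZMod k)) 3‖ ^ 2 =
      Real.pi ^ 6 / (90 * (k : ℝ) ^ 6) * (Nat.totient k : ℝ) *
        (jordanTotient 6 k / 21 - jordanTotient 2 k) := by
  have : NeZero k := ⟨by omega⟩
  have hk0 : (k : ℝ) ≠ 0 := by exact_mod_cast NeZero.ne k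
  have hodd : (fun j : ZMod k => hurwitzZetaOdd (ZMod.toAddCircle j) 3).Odd := fun j => by
    simp [hurwitzZetaOdd_neg]
  have hterm : ∀ χ ∈ oddCharacters k, ‖LSeries (fun n : ℕ => χ (n : ZMod k)) 3‖ ^ 2 =
      ((k : ℝ) ^ 6)⁻¹ * ‖∑ j : ZMod k, χ j * hurwitzZetaOdd (ZMod.toAddCircle j) 3‖ ^ 2 := by
    intro χ hχ
    have h3 : ((k : ℂ) ^ (3 : ℂ)) = (k : ℂ) ^ 3 := by
      exact_mod_cast Complex.cpow_natCast (k : ℂ) 3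
    rw [LSeries_three_of_odd (mem_oddCharacters.1 hχ), Complex.cpow_neg, h3, norm_mul, norm_inv,
      norm_pow, Complex.norm_natCast, mul_pow]
    ring
  rw [sum_congr rfl hterm, ← mul_sum, sum_oddCharacters_norm_sq hodd,
    sum_units_norm_sq_hurwitzZetaOdd_three (by omega)]
  field_simp

theorem theorem1 (k : ℕ) (hk : 3 ≤ k) :
    (∑ χ ∈ oddCharacters k, ‖LSeries (fun n : ℕ => χ (n : ZMod k)) 3‖ ^ 2 =
      Real.pi ^ 6 / (90 * (k : ℝ) ^ 6) * (Nat.totient k : ℝ) *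
        (jordanTotient 6 k / 21 - jordanTotient 2 k)) ∧
    ((∑ χ ∈ oddCharacters k, ‖LSeries (fun n : ℕ => χ (n : ZMod k)) 3‖ ^ 2) /
        ((oddCharacters k).card : ℝ) =
      2 * Real.pi ^ 6 / (90 * (k : ℝ) ^ 6) *
        (jordanTotient 6 k / 21 - jordanTotient 2 k)) := by
  refine ⟨sum_oddCharacters_norm_sq_LSeries_three hk, ?_⟩
  have hcard := two_mul_card_oddCharacters hk
  have hcard0 : ((oddCharacters k).card : ℝ) ≠ 0 := by
    have : (0 : ℝ) < k.totient := by exact_mod_cast Nat.totient_pos.2 (by omega)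
    intro h
    rw [h, mul_zero] at hcard
    exact this.ne hcard
  rw [sum_oddCharacters_norm_sq_LSeries_three hk, ← hcard, div_eq_iff hcard0]
  ring
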